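/- Let $q,a,\lambda$ be real with $0<|q|<1$ and $\lambda<0$. Write $(b;q)_n=\prod_{k=0}^{n-1}(1-bq^k)$, $(b;q)_\infty=\prod_{k\ge0}(1-bq^k)$ and $${}_0\phi_1(-;b;q,z)=\sum_{n\ge0}\frac{q^{n(n-1)}z^n}{(q;q)_n(b;q)_n}.$$ Let $Q_n$ and $Q_n^*$ be the polynomials satisfying $y_{k+1}(x)=(x+aq^k)y_k(x)+\lambda q^k y_{k-1}(x)$ for $k>0$, with $Q_0=1$, $Q_1=x+a$, $Q_0^*=0$, $Q_1^*=1$. (i) For every fixed complex $x\ne0$ with $x\ne-aq^j$ for all $j\ge0$, $$\lim_{n\to\infty}\frac{Q_n(x)}{x^n}=(-a/x;q)_\infty\;{}_0\phi_1(-;-a/x;q,\lambda q/x^2),$$ so that $Q_n(x)\sim x^n(-a/x;q)_\infty\,{}_0\phi_1(-;-a/x;q,\lambda q/x^2)$ whenever ${}_0\phi_1(-;-a/x;q,\lambda q/x^2)\neq0$. (ii) For every fixed complex $x\ne0$ with $x\ne-aq^{j}$ for all $j\ge1$, $$\lim_{n\to\infty}\frac{Q_n^*(x)}{x^{n-1}}=(-aq/x;q)_\infty\;{}_0\phi_1(-;-aq/x;q,\lambda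 q^2/x^2),$$ so that $Q_n^*(x)\sim x^{n-1}(-aq/x;q)_\infty\,{}_0\phi_1(-;-aq/x;q,\lambda q^2/x^2)$ whenever ${}_0\phi_1(-;-aq/x;q,\lambda q^2/x^2)\neq0$. (iii) Suppose in addition that $q>0$. Then there is exactly one positive Borel measure $\mu$ on $\mathbb R$ with finite moments such that $\int Q_nQ_m\,d\mu=(-\lambda)^nq^{n(n+1)/2}\delta_{mn}$ for all $m,n\ge0$. For every complex $x\notin\operatorname{supp}\mu$ the function $t\mapsto 1/(x-t)$ is $\mu$-integrable. If moreover $x\neq-aq^j$ for all $j\ge0$, then ${}_0\phi_1(-;-a/x;q,\lambda q/x^2)\ne0$ and $$\int_{-\infty}^{\infty}\frac{d\mu(t)}{x-t}=\frac1{x+a}\;\frac{{}_0\phi_1(-;-aq/x;q,\lambda q^2/x^2)}{{}_0\phi_1(-;-a/x;q,\lambda q/x^2)}.$$ At every $x\notin\operatorname{supp}\mu$, including points of the form $-aq^j$, the integral is the limit of the right-hand side, evaluated at $x'$, as $x'\to x$, $x'\neq x$. -/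

import Mathlib

open Filter Topology MeasureTheory Polynomial Asymptotics

noncomputable section

/-- The finite `q`-rising factorial `(b; q)_n = (1 - b)(1 - bq) ⋯ (1 - bq^{n-1})`. -/
def qPoch (b q : ℂ) (n : ℕ) : ℂ := ∏ k ∈ Finset.range n, (1 - b * q ^ k)

/-- The infinite `q`-rising factorial `(b; q)_∞ = ∏_{k ≥ 0} (1 - bq^k)`, used for `|q| < 1`. -/
def qPochInf (b q : ℂ) : ℂ := ∏' k : ℕ, (1 - b * q ^ k)

/-- The basic hypergeometric series `₀φ₁(-; b; q, z)`: here `1 + s - r = 2`, so the general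
term is `[(-1)^n q^{n(n-1)/2}]^2 z^n / ((q; q)_n (b; q)_n)`. It is used for `|q| < 1` and
`b ∉ {1, q⁻¹, q⁻², …}`, where no denominator vanishes and the series converges absolutely. -/
def phi01 (b q z : ℂ) : ℂ :=
  ∑' n : ℕ, ((-1) ^ n * q ^ n.choose 2) ^ 2 * z ^ n / (qPoch q q n * qPoch b q n)

/-- The denominator polynomials: `Q₀ = 1`, `Q₁ = x + a` and
`Q_{k+1} = (x + a q^k) Q_k + λ q^k Q_{k-1}` for `k > 0`. -/
def polyQ (q a lam : ℝ) : ℕ → ℝ[X]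
  | 0 => 1
  | 1 => X + C a
  | k + 2 => (X + C (a * q ^ (k + 1))) * polyQ q a lam (k + 1)
      + C (lam * q ^ (k + 1)) * polyQ q a lam k

/-- The numerator polynomials: the same recurrence with `Q₀* = 0`, `Q₁* = 1`. -/
def polyQStar (q a lam : ℝ) : ℕ → ℝ[X]
  | 0 => 0
  | 1 => 1
  | k + 2 => (X + C (a * q ^ (k + 1))) * polyQStar q a lam (k + 1)
      + C (lam * q ^ (k + 1)) * polyQStar q a lam k

/-- `μ` is a positive Borel measure on `ℝ` with finite moments for which
`∫ Q_n Q_m dμ = β₁ ⋯ β_n δ_{mn}`, where `β_k = -λ q^k`. -/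
structure IsOrthogonalityMeasure (q a lam : ℝ) (μ : Measure ℝ) : Prop where
  integrable_pow : ∀ n : ℕ, Integrable (fun t : ℝ => t ^ n) μ
  orthogonality : ∀ n m : ℕ,
    ∫ t, (polyQ q a lam n).eval t * (polyQ q a lam m).eval t ∂μ =
      if n = m then ∏ k ∈ Finset.Icc 1 n, (-lam * q ^ k) else 0

/-- The quotient `(x + a)⁻¹ ₀φ₁(-; -aq/x; q, λq²/x²) / ₀φ₁(-; -a/x; q, λq/x²)`. -/
def stieltjesQuotient (q a lam : ℝ) (x : ℂ) : ℂ :=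
  1 / (x + a) * (phi01 (-(a * q) / x) q (lam * q ^ 2 / x ^ 2) /
    phi01 (-a / x) q (lam * q / x ^ 2))

end

noncomputable section

/-! ### The regularised series -/

/-- The function `(b; q)_∞ · ₀φ₁(-; b; q, w)`, which extends to all values of `b`. -/
def phiReg (b q w : ℂ) : ℂ :=
  ∑' n : ℕ, (q ^ n.choose 2) ^ 2 * w ^ n * qPochInf (b * q ^ n) q / qPoch q q n

lemma summable_pow_mul_pow_choose_two (C : ℝ) {r : ℝ} (hr0 : 0 ≤ r) (hr1 : r < 1) :
    Summable fun n : ℕ => C ^ n * r ^ n.choose 2 := by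
  have h : Tendsto (fun n : ℕ => |C| * r ^ n) atTop (𝓝 0) := by
    simpa using (tendsto_pow_atTop_nhds_zero_of_lt_one hr0 hr1).const_mul |C|
  refine summable_of_ratio_norm_eventually_le (r := 1 / 2) (by norm_num) ?_
  filter_upwards [h.eventually_le_const (show (0 : ℝ) < 1 / 2 by norm_num)] with n hn
  have e : ‖C ^ (n + 1) * r ^ (n + 1).choose 2‖ = (|C| * r ^ n) * ‖C ^ n * r ^ n.choose 2‖ := by
    rw [Nat.choose_succ_succ' n 1, Nat.choose_one_right]
    simp only [norm_mul, norm_pow, Real.norm_eq_abs, abs_of_nonneg hr0]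
    ring
  rw [e]
  gcongr

lemma summable_norm_mul_pow (b : ℂ) {q : ℂ} (hq : ‖q‖ < 1) :
    Summable fun k : ℕ => ‖-(b * q ^ k)‖ := by
  simp only [norm_neg, norm_mul, norm_pow]
  exact (summable_geometric_of_lt_one (norm_nonneg q) hq).mul_left _

lemma multipliable_one_sub_mul_pow (b : ℂ) {q : ℂ} (hq : ‖q‖ < 1) :
    Multipliable fun k : ℕ => 1 - b * q ^ k := by
  simpa only [sub_eq_add_neg] using multipliable_one_add_of_summable (summable_norm_mul_pow b hq)

lemma qPochInf_ne_zero {b q : ℂ} (hq : ‖q‖ < 1) (h : ∀ k : ℕ, 1 - b * q ^ k ≠ 0) :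
    qPochInf b q ≠ 0 := by
  simp only [sub_eq_add_neg] at h
  simpa only [qPochInf, sub_eq_add_neg] using
    tprod_one_add_ne_zero_of_summable h (summable_norm_mul_pow b hq)

lemma qPochInf_eq_qPoch_mul (b : ℂ) {q : ℂ} (hq : ‖q‖ < 1) (n : ℕ) :
    qPochInf b q = qPoch b q n * qPochInf (b * q ^ n) q := by
  have e : (fun k : ℕ => 1 - b * q ^ (k + n)) = fun k => 1 - b * q ^ n * q ^ k := by
    ext k; ring
  have h := Multipliable.prod_mul_tprod_nat_mul' (f := fun k : ℕ => 1 - b * q ^ k) (k := n)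
    (by rw [e]; exact multipliable_one_sub_mul_pow _ hq)
  rw [e] at h
  exact h.symm

lemma norm_qPochInf_sub_one_le (b : ℂ) {q : ℂ} (hq : ‖q‖ < 1) :
    ‖qPochInf b q - 1‖ ≤ Real.exp (‖b‖ / (1 - ‖q‖)) - 1 := by
  have ht := ((multipliable_one_sub_mul_pow b hq).hasProd.tendsto_prod_nat.sub_const 1).norm
  refine le_of_tendsto' ht fun n => ?_
  have h := Finset.norm_prod_one_add_sub_one_le (Finset.range n) fun k => -(b * q ^ k)
  simp only [← sub_eq_add_neg] at h
  refine h.trans ?_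
  gcongr
  have hs := (summable_norm_mul_pow b hq).sum_le_tsum (Finset.range n) fun _ _ => norm_nonneg _
  refine hs.trans_eq ?_
  simp only [norm_neg, norm_mul, norm_pow]
  rw [tsum_mul_left, tsum_geometric_of_lt_one (norm_nonneg q) hq, div_eq_mul_inv]

lemma norm_qPochInf_le (b : ℂ) {q : ℂ} (hq : ‖q‖ < 1) :
    ‖qPochInf b q‖ ≤ Real.exp (‖b‖ / (1 - ‖q‖)) := by
  have h := norm_le_norm_sub_add (qPochInf b q) 1
  have h' := norm_qPochInf_sub_one_le b hq
  rw [norm_one] at h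
  linarith

lemma tendsto_qPochInf_mul_pow (b : ℂ) {q : ℂ} (hq : ‖q‖ < 1) :
    Tendsto (fun N : ℕ => qPochInf (b * q ^ N) q) atTop (𝓝 1) := by
  rw [tendsto_iff_norm_sub_tendsto_zero]
  refine squeeze_zero (fun _ => norm_nonneg _) (fun N => norm_qPochInf_sub_one_le _ hq) ?_
  have h : Tendsto (fun N : ℕ => Real.exp (‖b‖ * ‖q‖ ^ N / (1 - ‖q‖)) - 1) atTop
      (𝓝 (Real.exp (‖b‖ * 0 / (1 - ‖q‖)) - 1)) :=
    ((Real.continuous_exp.tendsto _).comp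
      (((tendsto_pow_atTop_nhds_zero_of_lt_one (norm_nonneg q) hq).const_mul _).div_const _)
        ).sub_const 1
  simpa using h

lemma one_sub_norm_pow_le_norm_qPoch {q : ℂ} (hq : ‖q‖ < 1) (n : ℕ) :
    (1 - ‖q‖) ^ n ≤ ‖qPoch q q n‖ := by
  rw [qPoch, norm_prod]
  rw [← Finset.card_range n, ← Finset.prod_const, Finset.card_range]
  refine Finset.prod_le_prod (fun _ _ => sub_nonneg.2 hq.le) fun k _ => ?_
  have h := norm_sub_norm_le (1 : ℂ) (q * q ^ k)
  have h1 : ‖q‖ ^ k ≤ 1 := pow_le_one₀ (norm_nonneg q) hq.le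
  rw [norm_one, norm_mul, norm_pow] at h
  nlinarith [norm_nonneg q]

lemma qPoch_self_ne_zero {q : ℂ} (hq : ‖q‖ < 1) (n : ℕ) : qPoch q q n ≠ 0 :=
  norm_pos_iff.1 ((pow_pos (sub_pos.2 hq) n).trans_le (one_sub_norm_pow_le_norm_qPoch hq n))

lemma norm_phiReg_term_le {b q w : ℂ} {B W : ℝ} (hq : ‖q‖ < 1) (hb : ‖b‖ ≤ B) (hw : ‖w‖ ≤ W)
    (n : ℕ) :
    ‖(q ^ n.choose 2) ^ 2 * w ^ n * qPochInf (b * q ^ n) q / qPoch q q n‖ ≤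
      Real.exp (B / (1 - ‖q‖)) * ((W / (1 - ‖q‖)) ^ n * ‖q‖ ^ n.choose 2) := by
  have hq' : 0 < 1 - ‖q‖ := sub_pos.2 hq
  have hqn : ∀ m : ℕ, ‖q‖ ^ m ≤ 1 := fun m => pow_le_one₀ (norm_nonneg q) hq.le
  have h1 : ‖qPochInf (b * q ^ n) q‖ ≤ Real.exp (B / (1 - ‖q‖)) := by
    refine (norm_qPochInf_le _ hq).trans ?_
    gcongr
    rw [norm_mul, norm_pow]
    nlinarith [hqn n, norm_nonneg b]
  have h2 : (‖q‖ ^ n.choose 2) ^ 2 ≤ ‖q‖ ^ n.choose 2 := by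
    nlinarith [hqn (n.choose 2), pow_nonneg (norm_nonneg q) (n.choose 2)]
  rw [norm_div, norm_mul, norm_mul, norm_pow, norm_pow, norm_pow]
  calc _ ≤ ‖q‖ ^ n.choose 2 * W ^ n * Real.exp (B / (1 - ‖q‖)) / (1 - ‖q‖) ^ n := by
        have hW : 0 ≤ W := (norm_nonneg w).trans hw
        have := one_sub_norm_pow_le_norm_qPoch hq n
        gcongr
    _ = _ := by rw [div_pow]; ring

lemma summable_phiReg_bound {q : ℂ} (hq : ‖q‖ < 1) (B W : ℝ) :
    Summable fun n : ℕ =>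
      Real.exp (B / (1 - ‖q‖)) * ((W / (1 - ‖q‖)) ^ n * ‖q‖ ^ n.choose 2) :=
  (summable_pow_mul_pow_choose_two _ (norm_nonneg q) hq).mul_left _

lemma summable_phiReg (b w : ℂ) {q : ℂ} (hq : ‖q‖ < 1) :
    Summable fun n : ℕ =>
      (q ^ n.choose 2) ^ 2 * w ^ n * qPochInf (b * q ^ n) q / qPoch q q n :=
  .of_norm_bounded (summable_phiReg_bound hq _ _) (norm_phiReg_term_le hq le_rfl le_rfl)

lemma phiReg_eq {b q w : ℂ} (hq : ‖q‖ < 1) (h : ∀ k : ℕ, 1 - b * q ^ k ≠ 0) :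
    phiReg b q w = qPochInf b q * phi01 b q w := by
  rw [phiReg, phi01, ← tsum_mul_left]
  congr 1 with n
  have h1 := qPoch_self_ne_zero hq n
  have h2 : qPoch b q n ≠ 0 := Finset.prod_ne_zero_iff.2 fun k _ => h k
  rw [qPochInf_eq_qPoch_mul b hq n, mul_pow,
    show ((-1 : ℂ) ^ n) ^ 2 = 1 by rw [← pow_mul, mul_comm, pow_mul]; norm_num]
  field_simp

lemma phiReg_recurrence (b c : ℂ) {q : ℂ} (hq : ‖q‖ < 1) :
    phiReg b q (c * q) = (1 - b) * phiReg (b * q) q (c * q ^ 2) +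
      c * q * phiReg (b * q ^ 2) q (c * q ^ 3) := by
  simp only [phiReg]
  rw [← tsum_mul_left, (summable_phiReg _ _ hq).tsum_eq_zero_add,
    ((summable_phiReg (b * q) (c * q ^ 2) hq).mul_left (1 - b)).tsum_eq_zero_add,
    ← tsum_mul_left, add_assoc, ← Summable.tsum_add]
  · congr 1
    · have := qPochInf_eq_qPoch_mul b hq 1
      simp only [qPoch, Finset.prod_range_one, pow_zero, mul_one, pow_one] at this
      simp [qPoch, this]
    · congr 1 with n
      have h0 : qPoch q q (n + 1) = qPoch q q n * (1 - q * q ^ n) := Finset.prod_range_succ _ _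
      have h1 := qPoch_self_ne_zero hq n
      have h2 := qPoch_self_ne_zero hq (n + 1)
      have h3 := qPochInf_eq_qPoch_mul (b * q ^ (n + 1)) hq 1
      simp only [qPoch, Finset.prod_range_one, pow_zero, mul_one, pow_one] at h3
      have e1 : b * q ^ (n + 1) * q = b * q ^ (n + 2) := by ring
      have e2 : b * q * q ^ (n + 1) = b * q ^ (n + 2) := by ring
      have e3 : b * q ^ 2 * q ^ n = b * q ^ (n + 2) := by ring
      rw [e1] at h3
      rw [h3, e2, e3, Nat.choose_succ_succ' n 1, Nat.choose_one_right]
      rw [h0] at h2 ⊢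
      have h4 := right_ne_zero_of_mul h2
      field_simp
      ring
  · exact (summable_nat_add_iff 1).2 ((summable_phiReg (b * q) (c * q ^ 2) hq).mul_left (1 - b))
  · exact (summable_phiReg (b * q ^ 2) (c * q ^ 3) hq).mul_left (c * q)

/-- The `N`-fold shift of `(b; q)_∞ · ₀φ₁(-; b; q, cq)`. -/
def phiShift (b q c : ℂ) (N : ℕ) : ℂ := phiReg (b * q ^ N) q (c * q ^ (N + 1))

lemma phiShift_recurrence (b c : ℂ) {q : ℂ} (hq : ‖q‖ < 1) (N : ℕ) :
    phiShift b q c N = (1 - b * q ^ N) * phiShift b q c (N + 1) +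
      c * q ^ (N + 1) * phiShift b q c (N + 2) := by
  have h := phiReg_recurrence (b * q ^ N) (c * q ^ N) hq
  simp only [phiShift]
  rw [show c * q ^ (N + 1) = c * q ^ N * q by ring, h]
  congr 3 <;> ring

lemma tendsto_phiShift (b c : ℂ) {q : ℂ} (hq : ‖q‖ < 1) :
    Tendsto (phiShift b q c) atTop (𝓝 1) := by
  have hqn : ∀ m : ℕ, ‖q‖ ^ m ≤ 1 := fun m => pow_le_one₀ (norm_nonneg q) hq.le
  have hlim : ∀ n : ℕ, Tendsto (fun N : ℕ => (q ^ n.choose 2) ^ 2 * (c * q ^ (N + 1)) ^ n *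
      qPochInf (b * q ^ N * q ^ n) q / qPoch q q n) atTop
      (𝓝 ((q ^ n.choose 2) ^ 2 * (c * 0) ^ n * 1 / qPoch q q n)) := fun n => by
    have h1 := (tendsto_add_atTop_iff_nat 1).2 (tendsto_pow_atTop_nhds_zero_of_norm_lt_one hq)
    have h2 := (tendsto_add_atTop_iff_nat n).2 (tendsto_qPochInf_mul_pow b hq)
    simp only [pow_add _ _ n, ← mul_assoc] at h2
    exact ((((h1.const_mul c).pow n).const_mul _).mul h2).div_const _
  have h := tendsto_tsum_of_dominated_convergence (summable_phiReg_bound hq ‖b‖ ‖c‖) hlim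
    (Eventually.of_forall fun N k => norm_phiReg_term_le hq
      (by rw [norm_mul, norm_pow]; nlinarith [hqn N, norm_nonneg b])
      (by rw [norm_mul, norm_pow]; nlinarith [hqn (N + 1), norm_nonneg c]) k)
  rw [tsum_eq_single 0 fun n hn => by simp [hn]] at h
  simp only [Nat.choose_zero_succ, pow_zero, one_pow, mul_one, qPoch, Finset.prod_range_zero,
    div_one] at h
  exact h

/-! ### Solutions of the three-term recurrence -/

lemma exists_norm_le_of_recurrence {b q c : ℂ} (hq : ‖q‖ < 1) {r : ℕ → ℂ}
    (hr : ∀ n, r (n + 2) = (1 - b * q ^ (n + 1)) * r (n + 1) + c * q ^ (n + 1) * r n) :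
    ∃ M, ∀ n, ‖r n‖ ≤ M := by
  set d := (‖b‖ + ‖c‖) * ‖q‖ with hd
  have hd0 : 0 ≤ d := by positivity
  set K := max ‖r 0‖ ‖r 1‖
  have hK : 0 ≤ K := (norm_nonneg _).trans (le_max_left _ _)
  have hq' : 0 < 1 - ‖q‖ := sub_pos.2 hq
  have key : ∀ n, max ‖r n‖ ‖r (n + 1)‖ ≤ K * ∏ j ∈ Finset.range n, (1 + d * ‖q‖ ^ j) := by
    intro n
    induction n with
    | zero => simp [K]
    | succ n ih =>
      set P := ∏ j ∈ Finset.range n, (1 + d * ‖q‖ ^ j)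
      have h0 := (le_max_left _ _).trans ih
      have h1 := (le_max_right _ _).trans ih
      have hP : 0 ≤ K * P := (norm_nonneg _).trans h0
      have hx : 0 ≤ d * ‖q‖ ^ n := by positivity
      rw [Finset.prod_range_succ, ← mul_assoc]
      refine max_le (by nlinarith) ?_
      rw [hr n]
      calc _ ≤ (1 + ‖b‖ * ‖q‖ ^ (n + 1)) * ‖r (n + 1)‖ + ‖c‖ * ‖q‖ ^ (n + 1) * ‖r n‖ := by
            refine (norm_add_le _ _).trans ?_
            rw [norm_mul, norm_mul, norm_mul, norm_pow]
            gcongr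
            refine (norm_sub_le _ _).trans ?_
            rw [norm_one, norm_mul, norm_pow]
        _ ≤ (1 + ‖b‖ * ‖q‖ ^ (n + 1)) * (K * P) + ‖c‖ * ‖q‖ ^ (n + 1) * (K * P) := by gcongr
        _ = _ := by rw [hd]; ring
  refine ⟨K * Real.exp (d / (1 - ‖q‖)), fun n => (le_max_left _ _).trans ((key n).trans ?_)⟩
  gcongr
  refine (Real.prod_one_add_le_exp_sum _ fun j => by positivity).trans ?_
  gcongr
  rw [← Finset.mul_sum, div_eq_mul_inv, ← tsum_geometric_of_lt_one (norm_nonneg q) hq]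
  gcongr
  exact (summable_geometric_of_lt_one (norm_nonneg q) hq).sum_le_tsum _ fun _ _ => by positivity

/-- A solution of the recurrence has the limit prescribed by its first two values. -/
lemma tendsto_of_recurrence {b q c : ℂ} (hq : ‖q‖ < 1) {r : ℕ → ℂ} (h0 : r 0 = 1)
    (h1 : r 1 = 1 - b)
    (hr : ∀ n, r (n + 2) = (1 - b * q ^ (n + 1)) * r (n + 1) + c * q ^ (n + 1) * r n) :
    Tendsto r atTop (𝓝 (phiShift b q c 0)) := by
  obtain ⟨M, hM⟩ := exists_norm_le_of_recurrence hq hr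
  set F := phiShift b q c
  have hF : Tendsto F atTop (𝓝 1) := tendsto_phiShift b c hq
  have inv : ∀ n, r (n + 1) * F (n + 1) + c * q ^ (n + 1) * r n * F (n + 2) = F 0 := by
    intro n
    induction n with
    | zero =>
      rw [h0, h1, show F 0 = _ from phiShift_recurrence b c hq 0]
      simp [F]
    | succ n ih =>
      rw [← ih, hr n, show F (n + 1) = _ from phiShift_recurrence b c hq (n + 1)]
      ring
  have hz : Tendsto (fun n : ℕ => c * q ^ (n + 1) * r n * F (n + 2)) atTop (𝓝 0) := by
    have hp := (tendsto_add_atTop_iff_nat 1).2 (tendsto_pow_atTop_nhds_zero_of_norm_lt_one hq)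
    have hpr : Tendsto (fun n : ℕ => q ^ (n + 1) * r n) atTop (𝓝 0) :=
      hp.zero_mul_isBoundedUnder_le (isBoundedUnder_of ⟨M, hM⟩)
    simpa [mul_assoc] using (hpr.const_mul c).mul ((tendsto_add_atTop_iff_nat 2).2 hF)
  have hF1 := (tendsto_add_atTop_iff_nat 1).2 hF
  rw [← tendsto_add_atTop_iff_nat 1]
  have h := (hz.const_sub (F 0)).div hF1 one_ne_zero
  rw [sub_zero, div_one] at h
  refine h.congr' ?_
  filter_upwards [hF1.eventually_ne one_ne_zero] with n hn
  rw [Pi.div_apply, ← inv n, div_eq_iff hn]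
  ring

lemma phiShift_zero_ne_zero {b q c : ℂ} (hq0 : q ≠ 0) (hq : ‖q‖ < 1) (hc : c ≠ 0)
    (h1 : phiShift b q c 0 = 0 → phiShift b q c 1 = 0) : phiShift b q c 0 ≠ 0 := by
  intro h0
  have key : ∀ n, phiShift b q c n = 0 ∧ phiShift b q c (n + 1) = 0 := by
    intro n
    induction n with
    | zero => exact ⟨h0, h1 h0⟩
    | succ n ih =>
      refine ⟨ih.2, ?_⟩
      have h := phiShift_recurrence b c hq n
      rw [ih.1, ih.2, mul_zero, zero_add] at h
      exact (mul_eq_zero.1 h.symm).resolve_left (mul_ne_zero hc (pow_ne_zero _ hq0))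
  have h := tendsto_phiShift b c hq
  rw [show phiShift b q c = fun _ => 0 from funext fun n => (key n).1] at h
  exact zero_ne_one (tendsto_nhds_unique tendsto_const_nhds h)

/-! ### Asymptotics of the polynomials -/

lemma polyQ_succ_succ (q a lam : ℝ) (n : ℕ) :
    polyQ q a lam (n + 2) = (X + C (a * q ^ (n + 1))) * polyQ q a lam (n + 1) +
      C (lam * q ^ (n + 1)) * polyQ q a lam n := rfl

lemma polyQStar_succ_succ (q a lam : ℝ) (n : ℕ) :
    polyQStar q a lam (n + 2) = (X + C (a * q ^ (n + 1))) * polyQStar q a lam (n + 1) +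
      C (lam * q ^ (n + 1)) * polyQStar q a lam n := rfl

lemma polyQStar_succ (q a lam : ℝ) (n : ℕ) :
    polyQStar q a lam (n + 1) = polyQ q (a * q) (lam * q) n := by
  induction n using Nat.twoStepInduction with
  | zero => rfl
  | one => simp [polyQStar, polyQ]
  | more n h0 h1 =>
    rw [polyQStar_succ_succ, polyQ_succ_succ, h0, h1]
    congr 3 <;> ring_nf

lemma tendsto_polyQ {q : ℝ} (hq : |q| < 1) (a lam : ℝ) {x : ℂ} (hx : x ≠ 0) :
    Tendsto (fun n : ℕ => aeval x (polyQ q a lam n) / x ^ n) atTop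
      (𝓝 (phiShift (-a / x) q (lam / x ^ 2) 0)) := by
  refine tendsto_of_recurrence (by simpa using hq) (by simp [polyQ]) ?_ fun n => ?_
  · simp [polyQ]
    field_simp
    ring
  · simp only [polyQ_succ_succ, map_add, map_mul, aeval_X, aeval_C, Complex.coe_algebraMap,
      Complex.ofReal_pow]
    field_simp
    ring

lemma tendsto_polyQStar {q : ℝ} (hq : |q| < 1) (a lam : ℝ) {x : ℂ} (hx : x ≠ 0) :
    Tendsto (fun n : ℕ => aeval x (polyQStar q a lam n) / x ^ ((n : ℤ) - 1)) atTop
      (𝓝 (phiShift (-a / x) q (lam / x ^ 2) 1)) := by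
  rw [← tendsto_add_atTop_iff_nat 1]
  have h := tendsto_polyQ hq (a * q) (lam * q) hx
  have e : phiShift (-(a * q : ℝ) / x) q ((lam * q : ℝ) / x ^ 2) 0 =
      phiShift (-a / x) q (lam / x ^ 2) 1 := by
    simp only [phiShift]
    push_cast
    congr 1 <;> ring
  rw [e] at h
  refine h.congr fun n => ?_
  rw [polyQStar_succ]
  simp

lemma one_sub_neg_div_mul_ne_zero {x u v : ℂ} (hx : x ≠ 0) (h : x ≠ -(u * v)) :
    1 - -u / x * v ≠ 0 := by
  intro h0
  apply h
  field_simp at h0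
  linear_combination h0

lemma one_sub_neg_div_mul_pow_ne_zero {q a : ℝ} {x : ℂ} (hx : x ≠ 0)
    (h : ∀ j : ℕ, x ≠ -(a * q ^ j)) (k : ℕ) : 1 - -(a : ℂ) / x * (q : ℂ) ^ k ≠ 0 :=
  one_sub_neg_div_mul_ne_zero hx (h k)

lemma one_sub_neg_mul_div_mul_pow_ne_zero {q a : ℝ} {x : ℂ} (hx : x ≠ 0)
    (h : ∀ j : ℕ, x ≠ -(a * q ^ (j + 1))) (k : ℕ) :
    1 - -(a * q : ℂ) / x * (q : ℂ) ^ k ≠ 0 :=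
  one_sub_neg_div_mul_ne_zero hx (by rw [mul_assoc, ← pow_succ']; exact h k)

lemma phiShift_zero_eq {q a lam : ℝ} (hq : |q| < 1) {x : ℂ} (hx : x ≠ 0)
    (h : ∀ j : ℕ, x ≠ -(a * q ^ j)) :
    phiShift (-a / x) q (lam / x ^ 2) 0 =
      qPochInf (-a / x) q * phi01 (-a / x) q (lam * q / x ^ 2) := by
  rw [← phiReg_eq (by simpa using hq) (one_sub_neg_div_mul_pow_ne_zero hx h), phiShift]
  congr 1 <;> ring

lemma phiShift_one_eq {q a lam : ℝ} (hq : |q| < 1) {x : ℂ} (hx : x ≠ 0)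
    (h : ∀ j : ℕ, x ≠ -(a * q ^ (j + 1))) :
    phiShift (-a / x) q (lam / x ^ 2) 1 =
      qPochInf (-(a * q) / x) q * phi01 (-(a * q) / x) q (lam * q ^ 2 / x ^ 2) := by
  rw [← phiReg_eq (by simpa using hq) (one_sub_neg_mul_div_mul_pow_ne_zero hx h), phiShift]
  congr 1 <;> ring

lemma isEquivalent_of_tendsto_div {u v : ℕ → ℂ} {L : ℂ} (hL : L ≠ 0) (hv : ∀ n, v n ≠ 0)
    (h : Tendsto (fun n => u n / v n) atTop (𝓝 L)) : u ~[atTop] fun n => v n * L := by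
  rw [isEquivalent_iff_tendsto_one (Eventually.of_forall fun n => mul_ne_zero (hv n) hL)]
  have := h.div_const L
  rw [div_self hL] at this
  refine this.congr fun n => ?_
  rw [Pi.div_apply, div_div]

theorem polyQ_asymptotics {q : ℝ} (hq : |q| < 1) (a lam : ℝ) {x : ℂ} (hx : x ≠ 0)
    (h : ∀ j : ℕ, x ≠ -(a * q ^ j)) :
    Tendsto (fun n : ℕ => aeval x (polyQ q a lam n) / x ^ n) atTop
        (𝓝 (qPochInf (-a / x) q * phi01 (-a / x) q (lam * q / x ^ 2))) ∧
      (phi01 (-a / x) q (lam * q / x ^ 2) ≠ 0 →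
        (fun n : ℕ => aeval x (polyQ q a lam n)) ~[atTop]
          fun n : ℕ => x ^ n * qPochInf (-a / x) q * phi01 (-a / x) q (lam * q / x ^ 2)) := by
  have ht := tendsto_polyQ hq a lam hx
  rw [phiShift_zero_eq hq hx h] at ht
  refine ⟨ht, fun h0 => ?_⟩
  have hp : qPochInf (-a / x) q ≠ 0 :=
    qPochInf_ne_zero (by simpa using hq) (one_sub_neg_div_mul_pow_ne_zero hx h)
  simpa only [mul_assoc] using
    isEquivalent_of_tendsto_div (mul_ne_zero hp h0) (fun n => pow_ne_zero n hx) ht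

theorem polyQStar_asymptotics {q : ℝ} (hq : |q| < 1) (a lam : ℝ) {x : ℂ} (hx : x ≠ 0)
    (h : ∀ j : ℕ, x ≠ -(a * q ^ (j + 1))) :
    Tendsto (fun n : ℕ => aeval x (polyQStar q a lam n) / x ^ ((n : ℤ) - 1)) atTop
        (𝓝 (qPochInf (-(a * q) / x) q * phi01 (-(a * q) / x) q (lam * q ^ 2 / x ^ 2))) ∧
      (phi01 (-(a * q) / x) q (lam * q ^ 2 / x ^ 2) ≠ 0 →
        (fun n : ℕ => aeval x (polyQStar q a lam n)) ~[atTop]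
          fun n : ℕ => x ^ ((n : ℤ) - 1) * qPochInf (-(a * q) / x) q *
            phi01 (-(a * q) / x) q (lam * q ^ 2 / x ^ 2)) := by
  have ht := tendsto_polyQStar hq a lam hx
  rw [phiShift_one_eq hq hx h] at ht
  refine ⟨ht, fun h0 => ?_⟩
  have hp : qPochInf (-(a * q) / x) q ≠ 0 :=
    qPochInf_ne_zero (by simpa using hq) (one_sub_neg_mul_div_mul_pow_ne_zero hx h)
  simpa only [mul_assoc] using
    isEquivalent_of_tendsto_div (mul_ne_zero hp h0) (fun n => zpow_ne_zero _ hx) ht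

/-! ### Existence of the orthogonality measure -/

section Spectral

variable {H : Type*} [NormedAddCommGroup H] [InnerProductSpace ℂ H] [CompleteSpace H]

/-- The positive functional `f ↦ ⟪v, f(T) v⟫` on the continuous functions on the spectrum. -/
def spectralFunctional {T : H →L[ℂ] H} (hT : IsSelfAdjoint T) (v : H) :
    CompactlySupportedContinuousMap (spectrum ℝ T) ℝ →ₚ[ℝ] ℝ :=
  PositiveLinearMap.mk₀
    { toFun := fun f => (inner ℂ v (cfcHom hT f.toContinuousMap v)).re
      map_add' := fun f g => by
        rw [show (f + g).toContinuousMap = f.toContinuousMap + g.toContinuousMap from rfl, map_add,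
          add_apply, inner_add_right, Complex.add_re]
      map_smul' := fun c f => by
        rw [show (c • f).toContinuousMap = c • f.toContinuousMap from rfl, map_smul,
          smul_apply, ← Complex.coe_smul, inner_smul_right,
          Complex.re_ofReal_mul]
        rfl }
    fun f hf => by
      have h : 0 ≤ cfcHom hT f.toContinuousMap := (cfcHom_nonneg_iff hT).2 hf
      exact ((ContinuousLinearMap.nonneg_iff_isPositive _).1 h).re_inner_nonneg_right v

lemma exists_spectral_measure {T : H →L[ℂ] H} (hT : IsSelfAdjoint T) (v : H) :
    ∃ μ : Measure ℝ, IsFiniteMeasure μ ∧ (∃ M, μ (Set.Icc (-M) M)ᶜ = 0) ∧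
      ∀ p : ℝ[X], Integrable (fun t => p.eval t) μ ∧
        ∫ t, p.eval t ∂μ = (inner ℂ v (aeval T p v)).re := by
  set ν := RealRMK.rieszMeasure (spectralFunctional hT v) with hν
  have hfin : IsFiniteMeasure ν := inferInstance
  have hemb : MeasurableEmbedding (Subtype.val : spectrum ℝ T → ℝ) :=
    .subtype_coe (spectrum.isClosed T).measurableSet
  refine ⟨ν.map Subtype.val, inferInstance, ?_, fun p => ?_⟩
  · obtain ⟨M, hM⟩ := (spectrum.isCompact (𝕜 := ℝ) T).isBounded.subset_closedBall 0
    refine ⟨M, ?_⟩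
    rw [hemb.map_apply]
    convert measure_empty (μ := ν)
    ext t
    have := hM t.2
    rw [Real.closedBall_eq_Icc, zero_sub, zero_add] at this
    simpa using this
  · let f : CompactlySupportedContinuousMap (spectrum ℝ T) ℝ :=
      { toFun := fun t => p.eval t.1
        continuous_toFun := p.continuous.comp continuous_subtype_val
        hasCompactSupport' := HasCompactSupport.of_compactSpace _ }
    refine ⟨(hemb.integrable_map_iff).2 f.integrable, ?_⟩
    rw [hemb.integral_map]
    refine (RealRMK.integral_rieszMeasure (spectralFunctional hT v) f).trans ?_
    have h := cfc_polynomial p T hT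
    rw [cfc_apply _ T hT] at h
    rw [← h]
    rfl

lemma IsSelfAdjoint.aeval_real {T : H →L[ℂ] H} (hT : IsSelfAdjoint T) (p : ℝ[X]) :
    IsSelfAdjoint (aeval T p) := by
  rw [← cfc_polynomial p T hT]
  exact cfc_predicate _ _

end Spectral

section Jacobi

variable {H : Type*} [NormedAddCommGroup H] [InnerProductSpace ℂ H]

open InnerProductSpace in
/-- The summands of a Jacobi operator. -/
def jacobiTerm (e : ℕ → H) (b w : ℕ → ℝ) (n : ℕ) : H →L[ℂ] H :=
  (b n : ℂ) • rankOne ℂ (e n) (e n) +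
    (w n : ℂ) • (rankOne ℂ (e n) (e (n + 1)) + rankOne ℂ (e (n + 1)) (e n))

lemma jacobiTerm_apply {e : ℕ → H} (he : Orthonormal ℂ e) (b w : ℕ → ℝ) (n m : ℕ) :
    jacobiTerm e b w n (e m) = (b n : ℂ) • (if n = m then (1 : ℂ) else 0) • e n +
      (w n : ℂ) • ((if n + 1 = m then (1 : ℂ) else 0) • e n +
        (if n = m then (1 : ℂ) else 0) • e (n + 1)) := by
  simp [jacobiTerm, orthonormal_iff_ite.1 he]

variable [CompleteSpace H]

lemma isSelfAdjoint_jacobiTerm (e : ℕ → H) (b w : ℕ → ℝ) (n : ℕ) :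
    IsSelfAdjoint (jacobiTerm e b w n) := by
  rw [ContinuousLinearMap.isSelfAdjoint_iff']
  simp only [jacobiTerm, map_add, map_smulₛₗ, InnerProductSpace.adjoint_rankOne,
    Complex.conj_ofReal]
  rw [add_comm (InnerProductSpace.rankOne ℂ (e (n + 1)) (e n))]

lemma summable_jacobiTerm {e : ℕ → H} (he : Orthonormal ℂ e) {b w : ℕ → ℝ}
    (hb : Summable fun n => |b n|) (hw : Summable fun n => |w n|) :
    Summable (jacobiTerm e b w) := by
  refine .of_norm_bounded (hb.add (hw.mul_right 2)) fun n => ?_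
  refine (norm_add_le _ _).trans ?_
  rw [norm_smul, norm_smul]
  have h : ∀ m, ‖e m‖ = 1 := he.1
  have h2 := norm_add_le (InnerProductSpace.rankOne ℂ (e n) (e (n + 1)))
    (InnerProductSpace.rankOne ℂ (e (n + 1)) (e n))
  simp only [InnerProductSpace.norm_rankOne, h, Complex.norm_real, Real.norm_eq_abs, mul_one]
    at h2 ⊢
  gcongr
  linarith

lemma tsum_jacobiTerm_apply {e : ℕ → H} (he : Orthonormal ℂ e) {b w : ℕ → ℝ}
    (hb : Summable fun n => |b n|) (hw : Summable fun n => |w n|) (x : H) :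
    HasSum (fun n => jacobiTerm e b w n x) ((∑' n, jacobiTerm e b w n) x) :=
  (summable_jacobiTerm he hb hw).hasSum.mapL (ContinuousLinearMap.apply ℂ H x)

lemma tsum_jacobiTerm_apply_zero {e : ℕ → H} (he : Orthonormal ℂ e) {b w : ℕ → ℝ}
    (hb : Summable fun n => |b n|) (hw : Summable fun n => |w n|) :
    (∑' n, jacobiTerm e b w n) (e 0) = (b 0 : ℂ) • e 0 + (w 0 : ℂ) • e 1 := by
  refine (tsum_jacobiTerm_apply he hb hw (e 0)).unique ?_
  convert hasSum_single 0 fun n hn => ?_ using 1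
  · simp [jacobiTerm_apply he]
  · simp [jacobiTerm_apply he, hn]

lemma tsum_jacobiTerm_apply_succ {e : ℕ → H} (he : Orthonormal ℂ e) {b w : ℕ → ℝ}
    (hb : Summable fun n => |b n|) (hw : Summable fun n => |w n|) (m : ℕ) :
    (∑' n, jacobiTerm e b w n) (e (m + 1)) =
      (w m : ℂ) • e m + (b (m + 1) : ℂ) • e (m + 1) + (w (m + 1) : ℂ) • e (m + 2) := by
  refine (tsum_jacobiTerm_apply he hb hw (e (m + 1))).unique ?_
  convert hasSum_sum_of_ne_finset_zero (L := .unconditional ℕ) (s := {m, m + 1})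
    fun n hn => ?_ using 1
  · rw [Finset.sum_pair (by simp)]
    simp [jacobiTerm_apply he, add_assoc]
  · simp only [Finset.mem_insert, Finset.mem_singleton, not_or] at hn
    simp [jacobiTerm_apply he, hn]

lemma aeval_polyQ_jacobi {e : ℕ → H} (he : Orthonormal ℂ e) {q a lam : ℝ} {b w : ℕ → ℝ}
    (hb : Summable fun n => |b n|) (hw : Summable fun n => |w n|)
    (hbq : ∀ n, b n = -(a * q ^ n)) (hwq : ∀ n, w n ^ 2 = -lam * q ^ (n + 1)) (n : ℕ) :
    aeval (∑' n, jacobiTerm e b w n) (polyQ q a lam n) (e 0) =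
      ((∏ j ∈ Finset.range n, w j : ℝ) : ℂ) • e n := by
  induction n using Nat.twoStepInduction with
  | zero => simp [polyQ]
  | one =>
    simp only [polyQ, map_add, aeval_X, aeval_C, add_apply,
      tsum_jacobiTerm_apply_zero he hb hw, hbq, ContinuousLinearMap.algebraMap_apply]
    rw [← Complex.coe_smul]
    simp
  | more n h0 h1 =>
    simp only [polyQ_succ_succ, map_add, map_mul, aeval_X, aeval_C, add_apply,
      mul_apply_eq_comp, ContinuousLinearMap.algebraMap_apply, h0, h1,
      map_smul, tsum_jacobiTerm_apply_succ he hb hw, hbq, Finset.prod_range_succ]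
    simp only [← Complex.coe_smul]
    have h : (w n : ℂ) ^ 2 = -lam * q ^ (n + 1) := by exact_mod_cast hwq n
    have h' : (lam : ℂ) • (q : ℂ) ^ (n + 1) • e n = (-(w n : ℂ) ^ 2) • e n := by
      rw [smul_smul, h]
      congr 1
      ring
    push_cast
    rw [h']
    module

end Jacobi

lemma prod_range_sq_eq_prod_Icc {q lam : ℝ} {w : ℕ → ℝ}
    (hw : ∀ n, w n ^ 2 = -lam * q ^ (n + 1)) (n : ℕ) :
    (∏ j ∈ Finset.range n, w j) ^ 2 = ∏ k ∈ Finset.Icc 1 n, (-lam * q ^ k) := by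
  induction n with
  | zero => simp
  | succ n ih => rw [Finset.prod_range_succ, mul_pow, ih, hw, Finset.prod_Icc_succ_top (by omega)]

lemma orthonormal_lp_single :
    Orthonormal ℂ fun n : ℕ => (lp.single 2 n (1 : ℂ) : lp (fun _ : ℕ => ℂ) 2) := by
  rw [orthonormal_iff_ite]
  intro i j
  rw [lp.inner_single_left, lp.single_apply]
  by_cases h : i = j
  · subst h; simp
  · simp [h]

theorem exists_isOrthogonalityMeasure {q a lam : ℝ} (hq0 : 0 < q) (hq1 : q < 1) (hlam : lam < 0) :
    ∃ μ : Measure ℝ, IsOrthogonalityMeasure q a lam μ ∧ ∃ M, μ (Set.Icc (-M) M)ᶜ = 0 := by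
  set w : ℕ → ℝ := fun n => √(-lam) * √q ^ (n + 1) with hwdef
  set b : ℕ → ℝ := fun n => -(a * q ^ n) with hbdef
  have hwq : ∀ n, w n ^ 2 = -lam * q ^ (n + 1) := fun n => by
    rw [hwdef, mul_pow, Real.sq_sqrt (by linarith), ← pow_mul, mul_comm (n + 1), pow_mul,
      Real.sq_sqrt hq0.le]
  have hsq : √q < 1 := by rw [Real.sqrt_lt' one_pos]; simpa
  have hw : Summable fun n => |w n| := by
    refine Summable.abs ?_
    simp only [hwdef, pow_succ, ← mul_assoc]
    exact ((summable_geometric_of_lt_one (Real.sqrt_nonneg q) hsq).mul_left _).mul_right _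
  have hb : Summable fun n => |b n| :=
    ((summable_geometric_of_lt_one hq0.le hq1).mul_left _).neg.abs
  set e := fun n : ℕ => (lp.single 2 n (1 : ℂ) : lp (fun _ : ℕ => ℂ) 2)
  have he : Orthonormal ℂ e := orthonormal_lp_single
  set J := ∑' n, jacobiTerm e b w n with hJdef
  have hJ : IsSelfAdjoint J := by
    have h := (summable_jacobiTerm he hb hw).hasSum.star
    simp only [(isSelfAdjoint_jacobiTerm e b w _).star_eq] at h
    exact h.unique (summable_jacobiTerm he hb hw).hasSum
  obtain ⟨μ, hfin, hM, hμ⟩ := exists_spectral_measure hJ (e 0)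
  refine ⟨μ, ⟨fun n => by simpa using (hμ (X ^ n)).1, fun n m => ?_⟩, hM⟩
  have h := (hμ (polyQ q a lam n * polyQ q a lam m)).2
  simp only [eval_mul, map_mul, mul_apply_eq_comp] at h
  rw [h, ← ContinuousLinearMap.adjoint_inner_left, (hJ.aeval_real _).adjoint_eq,
    aeval_polyQ_jacobi he hb hw (fun _ => rfl) hwq, aeval_polyQ_jacobi he hb hw (fun _ => rfl) hwq,
    inner_smul_left, inner_smul_right, orthonormal_iff_ite.1 he, ← prod_range_sq_eq_prod_Icc hwq,
    Complex.conj_ofReal]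
  split_ifs with hnm
  · subst hnm
    rw [mul_one, ← Complex.ofReal_mul, Complex.ofReal_re, sq]
  · simp

/-! ### Uniqueness of the orthogonality measure -/

lemma integrable_eval_of_integrable_pow {μ : Measure ℝ}
    (h : ∀ n : ℕ, Integrable (fun t : ℝ => t ^ n) μ) (p : ℝ[X]) :
    Integrable (fun t => p.eval t) μ := by
  simp only [eval_eq_sum_range]
  exact integrable_finsetSum _ fun i _ => (h i).const_mul _

lemma ae_abs_le_of_integral_pow_eq {μ ν : Measure ℝ} [IsFiniteMeasure μ] [IsFiniteMeasure ν]
    (hν : ∀ n : ℕ, Integrable (fun t : ℝ => t ^ n) ν) {M : ℝ} (hM0 : 0 ≤ M)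
    (hM : ∀ᵐ t ∂μ, |t| ≤ M) (h : ∀ n : ℕ, ∫ t, t ^ n ∂ν = ∫ t, t ^ n ∂μ) :
    ∀ᵐ t ∂ν, |t| ≤ M := by
  have key : ∀ k : ℕ, ∀ᵐ t ∂ν, |t| < M + 1 / ((k : ℝ) + 1) := by
    intro k
    set r := M + 1 / ((k : ℝ) + 1) with hr
    have hMr : M < r := by rw [hr]; linarith [Nat.one_div_pos_of_nat (α := ℝ) (n := k)]
    have hr0 : 0 < r := hM0.trans_lt hMr
    have hle : ∀ n : ℕ, ν.real {t | r ≤ |t|} ≤ μ.real Set.univ * ((M / r) ^ 2) ^ n := by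
      intro n
      have h1 := mul_meas_ge_le_integral_of_nonneg (μ := ν) (f := fun t : ℝ => t ^ (2 * n))
        (Eventually.of_forall fun t => (even_two_mul n).pow_nonneg t) (hν (2 * n)) (r ^ (2 * n))
      have hset : {t : ℝ | r ^ (2 * n) ≤ t ^ (2 * n)} ⊇ {t | r ≤ |t|} := fun t ht => by
        rw [Set.mem_ofPred_eq, ← (even_two_mul n).pow_abs t]
        exact pow_le_pow_left₀ hr0.le ht _
      have h2 : ∫ t, t ^ (2 * n) ∂μ ≤ M ^ (2 * n) * μ.real Set.univ := by
        refine (Real.le_norm_self _).trans (norm_integral_le_of_norm_le_const ?_)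
        filter_upwards [hM] with t ht
        rw [norm_pow, Real.norm_eq_abs]
        exact pow_le_pow_left₀ (abs_nonneg t) ht _
      rw [h] at h1
      have h3 := measureReal_mono (μ := ν) hset
      have hp : 0 < r ^ (2 * n) := pow_pos hr0 _
      rw [← pow_mul, div_pow, mul_div_assoc', le_div_iff₀ hp]
      nlinarith
    have hlim : Tendsto (fun n : ℕ => μ.real Set.univ * ((M / r) ^ 2) ^ n) atTop (𝓝 0) := by
      have h1 : M / r < 1 := (div_lt_one hr0).2 hMr
      have h0 : 0 ≤ M / r := by positivity
      simpa using (tendsto_pow_atTop_nhds_zero_of_lt_one (sq_nonneg (M / r))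
        (by nlinarith)).const_mul (μ.real Set.univ)
    have h0 : ν.real {t | r ≤ |t|} = 0 :=
      le_antisymm (ge_of_tendsto' hlim hle) measureReal_nonneg
    rw [measureReal_eq_zero_iff] at h0
    rw [ae_iff]
    simpa using h0
  filter_upwards [ae_all_iff.2 key] with t ht
  refine ge_of_tendsto' (x := atTop) ?_ fun k => (ht k).le
  simpa using (tendsto_one_div_add_atTop_nhds_zero_nat (𝕜 := ℝ)).const_add M

/-- A compactly supported finite measure is determined by its moments among all measures with
finite moments. -/
theorem measure_eq_of_integral_eval_eq {μ ν : Measure ℝ} [IsFiniteMeasure μ] [IsFiniteMeasure ν]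
    (hμ : ∀ n : ℕ, Integrable (fun t : ℝ => t ^ n) μ)
    (hν : ∀ n : ℕ, Integrable (fun t : ℝ => t ^ n) ν) {M : ℝ} (hM : ∀ᵐ t ∂μ, |t| ≤ M)
    (hM0 : 0 ≤ M) (h : ∀ p : ℝ[X], ∫ t, p.eval t ∂ν = ∫ t, p.eval t ∂μ) : ν = μ := by
  have hM' := ae_abs_le_of_integral_pow_eq hν hM0 hM fun n => by simpa using h (X ^ n)
  refine ext_of_forall_integral_eq_of_IsFiniteMeasure fun f => ?_
  refine eq_of_forall_dist_le fun ε hε => ?_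
  set K := ν.real Set.univ + μ.real Set.univ + 1
  have hK : 0 < K := by positivity
  obtain ⟨p, hp⟩ := exists_polynomial_near_of_continuousOn (-M) M f f.continuous.continuousOn
    (ε / K) (by positivity)
  have approx : ∀ ρ : Measure ℝ, IsFiniteMeasure ρ → (∀ᵐ t ∂ρ, |t| ≤ M) →
      (∀ n : ℕ, Integrable (fun t : ℝ => t ^ n) ρ) →
      |∫ t, p.eval t ∂ρ - ∫ t, f t ∂ρ| ≤ ε / K * ρ.real Set.univ := by
    intro ρ _ hρ hi
    rw [← integral_sub (integrable_eval_of_integrable_pow hi p) (f.integrable ρ), ← Real.norm_eq_abs]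
    refine norm_integral_le_of_norm_le_const ?_
    filter_upwards [hρ] with t ht
    exact (hp t (abs_le.1 ht)).le
  have h1 := approx ν inferInstance hM' hν
  have h2 := approx μ inferInstance hM hμ
  rw [h p] at h1
  rw [abs_sub_comm] at h1
  rw [Real.dist_eq]
  calc _ ≤ _ := abs_sub_le _ (∫ t, p.eval t ∂μ) _
    _ ≤ ε / K * ν.real Set.univ + ε / K * μ.real Set.univ := add_le_add h1 h2
    _ ≤ ε / K * K := by
      rw [← mul_add]
      gcongr
      simp [K]
    _ = ε := div_mul_cancel₀ _ hK.ne'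

lemma span_range_polyQ (q a lam : ℝ) :
    Submodule.span ℝ (Set.range (polyQ q a lam)) = ⊤ := by
  set S := Submodule.span ℝ (Set.range (polyQ q a lam))
  have hQ : ∀ n, polyQ q a lam n ∈ S := fun n => Submodule.subset_span ⟨n, rfl⟩
  have hX : ∀ p ∈ S, X * p ∈ S := by
    intro p hp
    induction hp using Submodule.span_induction with
    | mem p hp =>
      obtain ⟨n, rfl⟩ := hp
      cases n with
      | zero =>
        have e : X * polyQ q a lam 0 = polyQ q a lam 1 - a • polyQ q a lam 0 := by
          simp [polyQ, smul_eq_C_mul]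
        rw [e]
        exact S.sub_mem (hQ _) (S.smul_mem _ (hQ _))
      | succ n =>
        have e : X * polyQ q a lam (n + 1) = polyQ q a lam (n + 2) -
            (a * q ^ (n + 1)) • polyQ q a lam (n + 1) - (lam * q ^ (n + 1)) • polyQ q a lam n := by
          rw [polyQ_succ_succ, smul_eq_C_mul, smul_eq_C_mul]
          ring
        rw [e]
        exact S.sub_mem (S.sub_mem (hQ _) (S.smul_mem _ (hQ _))) (S.smul_mem _ (hQ _))
    | zero => simp
    | add p r _ _ hp hr => rw [mul_add]; exact S.add_mem hp hr
    | smul c p _ hp => rw [mul_smul_comm]; exact S.smul_mem c hp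
  have hpow : ∀ n : ℕ, (X ^ n : ℝ[X]) ∈ S := by
    intro n
    induction n with
    | zero => exact hQ 0
    | succ n ih => rw [pow_succ']; exact hX _ ih
  rw [eq_top_iff]
  intro p _
  rw [p.as_sum_range_C_mul_X_pow]
  refine S.sum_mem fun i _ => ?_
  rw [← smul_eq_C_mul]
  exact S.smul_mem _ (hpow i)

namespace IsOrthogonalityMeasure

variable {q a lam : ℝ} {μ ν : Measure ℝ}

lemma integral_polyQ (h : IsOrthogonalityMeasure q a lam μ) (n : ℕ) :
    ∫ t, (polyQ q a lam n).eval t ∂μ = if n = 0 then 1 else 0 := by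
  have h := h.orthogonality n 0
  simp only [polyQ, eval_one, mul_one] at h
  rw [h]
  split_ifs with h0
  · simp [h0]
  · rfl

lemma isProbabilityMeasure (h : IsOrthogonalityMeasure q a lam μ) : IsProbabilityMeasure μ := by
  have h0 := h.integral_polyQ 0
  simp only [polyQ, eval_one, integral_const, smul_eq_mul, mul_one, if_true] at h0
  exact ⟨by rwa [Measure.real, ENNReal.toReal_eq_one_iff] at h0⟩

lemma integrable_eval (h : IsOrthogonalityMeasure q a lam μ) (p : ℝ[X]) :
    Integrable (fun t => p.eval t) μ :=
  integrable_eval_of_integrable_pow h.integrable_pow p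

lemma integral_eval_eq (hμ : IsOrthogonalityMeasure q a lam μ)
    (hν : IsOrthogonalityMeasure q a lam ν) (p : ℝ[X]) :
    ∫ t, p.eval t ∂ν = ∫ t, p.eval t ∂μ := by
  have hp : p ∈ Submodule.span ℝ (Set.range (polyQ q a lam)) := by
    rw [span_range_polyQ]
    trivial
  induction hp using Submodule.span_induction with
  | mem p hp =>
    obtain ⟨n, rfl⟩ := hp
    rw [hμ.integral_polyQ, hν.integral_polyQ]
  | zero => simp
  | add p r _ _ hp hr =>
    simp only [eval_add]
    rw [integral_add (hν.integrable_eval p) (hν.integrable_eval r),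
      integral_add (hμ.integrable_eval p) (hμ.integrable_eval r), hp, hr]
  | smul c p _ hp =>
    simp only [eval_smul, smul_eq_mul, integral_const_mul, hp]

theorem unique (hμ : IsOrthogonalityMeasure q a lam μ) {M : ℝ}
    (hM : μ (Set.Icc (-M) M)ᶜ = 0) (hν : IsOrthogonalityMeasure q a lam ν) : ν = μ := by
  have := hμ.isProbabilityMeasure
  have := hν.isProbabilityMeasure
  have hM' : ∀ᵐ t ∂μ, |t| ≤ |M| := by
    have h : ∀ᵐ t ∂μ, t ∈ Set.Icc (-M) M := hM
    filter_upwards [h] with t ht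
    exact (abs_le.2 ht).trans (le_abs_self M)
  exact measure_eq_of_integral_eval_eq hμ.integrable_pow hν.integrable_pow hM' (abs_nonneg M)
    (hμ.integral_eval_eq hν)

end IsOrthogonalityMeasure

/-! ### The Stieltjes transform -/

lemma prod_Icc_eq_pow_mul_pow_choose (q lam : ℝ) (n : ℕ) :
    ∏ k ∈ Finset.Icc 1 n, (-lam * q ^ k) = (-lam * q) ^ n * q ^ n.choose 2 := by
  induction n with
  | zero => simp
  | succ n ih =>
    rw [Finset.prod_Icc_succ_top (by omega), ih, Nat.choose_succ_succ' n 1, Nat.choose_one_right]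
    ring

section Resolvent

variable {μ : Measure ℝ} {x : ℂ}

lemma notMem_image_support (hx : ∀ t ∈ μ.support, x ≠ (t : ℂ)) :
    x ∉ algebraMap ℝ ℂ '' μ.support := by
  rintro ⟨t, ht, rfl⟩
  exact hx t ht rfl

lemma one_div_sub_eq_neg_resolvent (x : ℂ) (t : ℝ) : 1 / (x - (t : ℂ)) = -resolvent x t := by
  rw [resolvent, Ring.inverse_eq_inv', Complex.coe_algebraMap, ← neg_sub, one_div, inv_neg]

lemma exists_norm_one_div_sub_le (hx : ∀ t ∈ μ.support, x ≠ (t : ℂ)) :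
    ∃ K, ∀ᵐ t : ℝ ∂μ, ‖1 / (x - (t : ℂ))‖ ≤ K := by
  refine ⟨(Metric.infDist x (algebraMap ℝ ℂ '' μ.support))⁻¹, ?_⟩
  filter_upwards [Measure.support_mem_ae (μ := μ)] with t ht
  rw [one_div_sub_eq_neg_resolvent, norm_neg]
  exact norm_resolvent_le_inv_infDist_support (notMem_image_support hx) ht

lemma integrable_one_div_sub [IsFiniteMeasure μ] (hx : ∀ t ∈ μ.support, x ≠ (t : ℂ)) :
    Integrable (fun t : ℝ => 1 / (x - (t : ℂ))) μ := by
  simp only [one_div_sub_eq_neg_resolvent]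
  exact (integrable_resolvent (notMem_image_support hx)).neg

lemma continuousAt_integral_one_div_sub [IsFiniteMeasure μ]
    (hx : ∀ t ∈ μ.support, x ≠ (t : ℂ)) :
    ContinuousAt (fun y : ℂ => ∫ t : ℝ, 1 / (y - (t : ℂ)) ∂μ) x := by
  simp only [one_div_sub_eq_neg_resolvent, integral_neg]
  exact (hasDerivAt_resolventTransform x (notMem_image_support hx)).continuousAt.neg

lemma eventually_forall_support_ne (hx : ∀ t ∈ μ.support, x ≠ (t : ℂ)) :
    ∀ᶠ y : ℂ in 𝓝 x, ∀ t ∈ μ.support, y ≠ (t : ℂ) := by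
  have hc : IsClosed (Complex.ofReal '' μ.support) :=
    Complex.isometry_ofReal.isClosedEmbedding.isClosedMap _ Measure.isClosed_support
  filter_upwards [hc.isOpen_compl.mem_nhds (notMem_image_support hx)] with y hy t ht h
  exact hy ⟨t, ht, h.symm⟩

end Resolvent

namespace IsOrthogonalityMeasure

variable {q a lam : ℝ} {μ : Measure ℝ}

lemma integral_sq (h : IsOrthogonalityMeasure q a lam μ) (n : ℕ) :
    ∫ t, (polyQ q a lam n).eval t ^ 2 ∂μ = (-lam * q) ^ n * q ^ n.choose 2 := by
  have h := h.orthogonality n n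
  rw [if_pos rfl, prod_Icc_eq_pow_mul_pow_choose] at h
  simpa only [sq] using h

lemma integrable_sq (h : IsOrthogonalityMeasure q a lam μ) (n : ℕ) :
    Integrable (fun t => (polyQ q a lam n).eval t ^ 2) μ :=
  (h.integrable_eval (polyQ q a lam n ^ 2)).congr (.of_forall fun _ => eval_pow 2)

/-- Zero belongs to the support, as `∫ t² Q_n² dμ` is negligible against `∫ Q_n² dμ`. -/
theorem zero_mem_support (h : IsOrthogonalityMeasure q a lam μ) (hq0 : 0 < q) (hq1 : q < 1)
    (hlam : lam < 0) : (0 : ℝ) ∈ μ.support := by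
  by_contra h0
  obtain ⟨U, hU, hU0⟩ := Measure.notMem_support_iff_exists.1 h0
  obtain ⟨ε, hε, hεU⟩ := Metric.mem_nhds_iff.1 hU
  have hae : ∀ᵐ t ∂μ, ε ≤ |t| := by
    have : ∀ᵐ t ∂μ, t ∉ U := by rw [ae_iff]; simpa using hU0
    filter_upwards [this] with t ht
    by_contra! hlt
    exact ht (hεU (by simpa using hlt))
  have key : ∀ n : ℕ, ε ^ 2 ≤ 3 * ((-lam * q ^ 2 + -lam * q) * q ^ n + a ^ 2 * (q ^ (n + 1)) ^ 2) := by
    intro n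
    have hle : ∫ t, ε ^ 2 * (polyQ q a lam (n + 1)).eval t ^ 2 ∂μ ≤
        ∫ t, 3 * ((polyQ q a lam (n + 2)).eval t ^ 2 +
          ((a * q ^ (n + 1)) ^ 2 * (polyQ q a lam (n + 1)).eval t ^ 2 +
            (lam * q ^ (n + 1)) ^ 2 * (polyQ q a lam n).eval t ^ 2)) ∂μ := by
      refine integral_mono_ae ((h.integrable_sq _).const_mul _) (((h.integrable_sq _).add
        (((h.integrable_sq _).const_mul _).add ((h.integrable_sq _).const_mul _))).const_mul _) ?_
      filter_upwards [hae] with t ht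
      have e : t * (polyQ q a lam (n + 1)).eval t = (polyQ q a lam (n + 2)).eval t -
          a * q ^ (n + 1) * (polyQ q a lam (n + 1)).eval t -
          lam * q ^ (n + 1) * (polyQ q a lam n).eval t := by
        rw [polyQ_succ_succ]
        simp only [eval_add, eval_mul, eval_X, eval_C]
        ring
      have h1 : ε ^ 2 ≤ t ^ 2 := by rw [← sq_abs t]; gcongr
      calc _ ≤ t ^ 2 * (polyQ q a lam (n + 1)).eval t ^ 2 := by gcongr
        _ = (t * (polyQ q a lam (n + 1)).eval t) ^ 2 := by ring
        _ ≤ _ := by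
          rw [e]
          generalize (polyQ q a lam (n + 2)).eval t = u
          generalize hv : a * q ^ (n + 1) * (polyQ q a lam (n + 1)).eval t = v
          generalize hw : lam * q ^ (n + 1) * (polyQ q a lam n).eval t = w
          rw [← mul_pow, ← mul_pow, hv, hw]
          nlinarith [sq_nonneg (u + v), sq_nonneg (u + w), sq_nonneg (v - w)]
    have hsum : ∫ t, ((polyQ q a lam (n + 2)).eval t ^ 2 +
          ((a * q ^ (n + 1)) ^ 2 * (polyQ q a lam (n + 1)).eval t ^ 2 +
            (lam * q ^ (n + 1)) ^ 2 * (polyQ q a lam n).eval t ^ 2)) ∂μ =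
        ∫ t, (polyQ q a lam (n + 2)).eval t ^ 2 ∂μ +
          (∫ t, (a * q ^ (n + 1)) ^ 2 * (polyQ q a lam (n + 1)).eval t ^ 2 ∂μ +
            ∫ t, (lam * q ^ (n + 1)) ^ 2 * (polyQ q a lam n).eval t ^ 2 ∂μ) := by
      rw [integral_add, integral_add]
      · exact (h.integrable_sq _).const_mul _
      · exact (h.integrable_sq _).const_mul _
      · exact h.integrable_sq _
      · exact ((h.integrable_sq _).const_mul _).add ((h.integrable_sq _).const_mul _)
    rw [integral_const_mul, integral_const_mul, hsum, integral_const_mul, integral_const_mul,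
      h.integral_sq, h.integral_sq, h.integral_sq] at hle
    have hpos : 0 < (-lam * q) ^ (n + 1) * q ^ (n + 1).choose 2 := by
      have : 0 < -lam := neg_pos.2 hlam
      positivity
    refine le_of_mul_le_mul_right (hle.trans_eq ?_) hpos
    rw [Nat.choose_succ_succ' (n + 1) 1, Nat.choose_succ_succ' n 1, Nat.choose_one_right,
      Nat.choose_one_right]
    ring
  have hq := tendsto_pow_atTop_nhds_zero_of_lt_one hq0.le hq1
  have hlim := ((hq.const_mul (-lam * q ^ 2 + -lam * q)).add
    ((((tendsto_add_atTop_iff_nat 1).2 hq).pow 2).const_mul (a ^ 2))).const_mul 3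
  exact absurd (ge_of_tendsto' hlim key) (by simpa using hε.ne')

lemma integral_abs_le (h : IsOrthogonalityMeasure q a lam μ) (hq0 : 0 < q) (hlam : lam < 0)
    (n : ℕ) : ∫ t, |(polyQ q a lam n).eval t| ∂μ ≤ √((-lam * q) ^ n * q ^ n.choose 2) := by
  have := h.isProbabilityMeasure
  have hl : 0 < -lam := neg_pos.2 hlam
  set H := (-lam * q) ^ n * q ^ n.choose 2 with hH
  have hHpos : 0 < H := by positivity
  have hs : 0 < √H := Real.sqrt_pos.2 hHpos
  have hle : ∫ t, |(polyQ q a lam n).eval t| ∂μ ≤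
      ∫ t, ((2 * √H)⁻¹ * (polyQ q a lam n).eval t ^ 2 + √H / 2) ∂μ := by
    refine integral_mono (h.integrable_eval _).abs
      (((h.integrable_sq n).const_mul _).add (integrable_const _)) fun t => ?_
    have h1 := sq_nonneg (|(polyQ q a lam n).eval t| - √H)
    have h2 := sq_abs ((polyQ q a lam n).eval t)
    dsimp only
    rw [← h2, inv_mul_eq_div, ← sub_nonneg]
    have : |(polyQ q a lam n).eval t| ^ 2 / (2 * √H) + √H / 2 - |(polyQ q a lam n).eval t| =
        (|(polyQ q a lam n).eval t| - √H) ^ 2 / (2 * √H) := by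
      field_simp
      ring
    rw [this]
    positivity
  refine hle.trans_eq ?_
  rw [integral_add ((h.integrable_sq n).const_mul _) (integrable_const _), integral_const_mul,
    h.integral_sq, ← hH, integral_const]
  simp only [probReal_univ, one_smul]
  field_simp
  rw [Real.sq_sqrt hHpos.le]
  ring

/-- The functions of the second kind. -/
lemma integral_polyQ_div_sub (h : IsOrthogonalityMeasure q a lam μ) {x : ℂ}
    (hx : ∀ t ∈ μ.support, x ≠ (t : ℂ)) (n : ℕ) :
    ∫ t : ℝ, (((polyQ q a lam n).eval t : ℝ) : ℂ) * (1 / (x - (t : ℂ))) ∂μ =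
      (∫ t : ℝ, 1 / (x - (t : ℂ)) ∂μ) * aeval x (polyQ q a lam n) -
        aeval x (polyQStar q a lam n) := by
  have := h.isProbabilityMeasure
  obtain ⟨K, hK⟩ := exists_norm_one_div_sub_le hx
  have hi := integrable_one_div_sub hx
  have hQ : ∀ n, Integrable (fun t : ℝ => (((polyQ q a lam n).eval t : ℝ) : ℂ)) μ := fun n =>
    (h.integrable_eval _).ofReal
  have hQi : ∀ n, Integrable
      (fun t : ℝ => (((polyQ q a lam n).eval t : ℝ) : ℂ) * (1 / (x - (t : ℂ)))) μ := fun n =>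
    (hQ n).mul_bdd hi.aestronglyMeasurable hK
  have hne : ∀ᵐ t : ℝ ∂μ, x - (t : ℂ) ≠ 0 := by
    filter_upwards [Measure.support_mem_ae (μ := μ)] with t ht using sub_ne_zero.2 (hx t ht)
  induction n using Nat.twoStepInduction with
  | zero => simp [polyQ, polyQStar]
  | one =>
    have e : ∫ t : ℝ, (((polyQ q a lam 1).eval t : ℝ) : ℂ) * (1 / (x - (t : ℂ))) ∂μ =
        ∫ t : ℝ, ((x + a) * (1 / (x - (t : ℂ))) - 1) ∂μ := by
      refine integral_congr_ae ?_
      filter_upwards [hne] with t ht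
      simp only [polyQ, eval_add, eval_X, eval_C]
      push_cast
      field_simp
      ring
    rw [e, integral_sub (hi.const_mul _) (integrable_const _), integral_const_mul]
    simp [polyQ, polyQStar]
    ring
  | more n h0 h1 =>
    have e : ∫ t : ℝ, (((polyQ q a lam (n + 2)).eval t : ℝ) : ℂ) * (1 / (x - (t : ℂ))) ∂μ =
        ∫ t : ℝ, ((x + a * q ^ (n + 1)) *
          ((((polyQ q a lam (n + 1)).eval t : ℝ) : ℂ) * (1 / (x - (t : ℂ)))) +
          lam * q ^ (n + 1) * ((((polyQ q a lam n).eval t : ℝ) : ℂ) * (1 / (x - (t : ℂ)))) -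
          (((polyQ q a lam (n + 1)).eval t : ℝ) : ℂ)) ∂μ := by
      refine integral_congr_ae ?_
      filter_upwards [hne] with t ht
      simp only [polyQ_succ_succ, eval_add, eval_mul, eval_X, eval_C]
      push_cast
      field_simp
      ring
    rw [e, integral_sub ?_ (hQ _), integral_add ((hQi _).const_mul _) ((hQi _).const_mul _),
      integral_const_mul, integral_const_mul, h0, h1, integral_complex_ofReal, h.integral_polyQ]
    simp only [polyQ_succ_succ, polyQStar_succ_succ, map_add, map_mul, aeval_X, aeval_C,
      Complex.coe_algebraMap]
    · push_cast
      simp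
      ring
    · exact ((hQi _).const_mul _).add ((hQi _).const_mul _)

lemma tendsto_integral_polyQ_div_sub (h : IsOrthogonalityMeasure q a lam μ) (hq0 : 0 < q)
    (hq1 : q < 1) (hlam : lam < 0) {x : ℂ} (hx0 : x ≠ 0) (hx : ∀ t ∈ μ.support, x ≠ (t : ℂ)) :
    Tendsto (fun n : ℕ =>
      (∫ t : ℝ, (((polyQ q a lam n).eval t : ℝ) : ℂ) * (1 / (x - (t : ℂ))) ∂μ) / x ^ n) atTop (𝓝 0) := by
  have hl : 0 < -lam := neg_pos.2 hlam
  obtain ⟨K, hK⟩ := exists_norm_one_div_sub_le hx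
  have hx' : 0 < ‖x‖ := norm_pos_iff.2 hx0
  refine squeeze_zero_norm
    (a := fun n => |K| * √((-lam * q / ‖x‖ ^ 2) ^ n * q ^ n.choose 2)) (fun n => ?_) ?_
  · have h1 : ‖∫ t : ℝ, (((polyQ q a lam n).eval t : ℝ) : ℂ) * (1 / (x - (t : ℂ))) ∂μ‖ ≤
        ∫ t, |K| * |(polyQ q a lam n).eval t| ∂μ := by
      refine norm_integral_le_of_norm_le ((h.integrable_eval _).abs.const_mul _) ?_
      filter_upwards [hK] with t ht
      rw [norm_mul, mul_comm, Complex.norm_real, Real.norm_eq_abs]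
      gcongr
      exact ht.trans (le_abs_self K)
    rw [integral_const_mul] at h1
    have h2 : √((-lam * q / ‖x‖ ^ 2) ^ n * q ^ n.choose 2) =
        √((-lam * q) ^ n * q ^ n.choose 2) / ‖x‖ ^ n := by
      rw [div_pow, div_mul_eq_mul_div, Real.sqrt_div' _ (by positivity), ← pow_mul, mul_comm 2 n,
        pow_mul, Real.sqrt_sq (by positivity)]
    rw [norm_div, norm_pow, h2, mul_div_assoc']
    gcongr
    exact h1.trans (by gcongr; exact h.integral_abs_le hq0 hlam n)
  · have h1 := (summable_pow_mul_pow_choose_two (-lam * q / ‖x‖ ^ 2) hq0.le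
      hq1).tendsto_atTop_zero
    simpa using ((Real.continuous_sqrt.tendsto 0).comp h1).const_mul |K|

lemma integral_mul_phiShift (h : IsOrthogonalityMeasure q a lam μ) (hq0 : 0 < q)
    (hq1 : q < 1) (hlam : lam < 0) {x : ℂ} (hx0 : x ≠ 0) (hx : ∀ t ∈ μ.support, x ≠ (t : ℂ)) :
    (∫ t : ℝ, 1 / (x - (t : ℂ)) ∂μ) * phiShift (-a / x) q (lam / x ^ 2) 0 =
      phiShift (-a / x) q (lam / x ^ 2) 1 / x := by
  have hq : |q| < 1 := by rwa [abs_of_pos hq0]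
  have hd := ((tendsto_polyQ hq a lam hx0).const_mul (∫ t : ℝ, 1 / (x - (t : ℂ)) ∂μ)).sub
    ((tendsto_polyQStar hq a lam hx0).div_const x)
  rw [← sub_eq_zero]
  refine tendsto_nhds_unique (hd.congr fun n => ?_)
    (h.tendsto_integral_polyQ_div_sub hq0 hq1 hlam hx0 hx)
  rw [h.integral_polyQ_div_sub hx, zpow_sub_one₀ hx0, zpow_natCast]
  field_simp

lemma phiShift_ne_zero (h : IsOrthogonalityMeasure q a lam μ) (hq0 : 0 < q)
    (hq1 : q < 1) (hlam : lam < 0) {x : ℂ} (hx0 : x ≠ 0) (hx : ∀ t ∈ μ.support, x ≠ (t : ℂ)) :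
    phiShift (-a / x) q (lam / x ^ 2) 0 ≠ 0 := by
  refine phiShift_zero_ne_zero (by exact_mod_cast hq0.ne') (by simpa [abs_of_pos hq0])
    (div_ne_zero (by exact_mod_cast hlam.ne) (pow_ne_zero 2 hx0)) fun h0 => ?_
  have h1 := h.integral_mul_phiShift hq0 hq1 hlam hx0 hx
  rw [h0, mul_zero, eq_comm, div_eq_zero_iff] at h1
  exact h1.resolve_right hx0

theorem integral_eq_stieltjesQuotient (h : IsOrthogonalityMeasure q a lam μ) (hq0 : 0 < q)
    (hq1 : q < 1) (hlam : lam < 0) {x : ℂ} (hx : ∀ t ∈ μ.support, x ≠ (t : ℂ))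
    (hxa : ∀ j : ℕ, x ≠ -(a * q ^ j)) :
    phi01 (-a / x) q (lam * q / x ^ 2) ≠ 0 ∧
      ∫ t : ℝ, 1 / (x - (t : ℂ)) ∂μ = stieltjesQuotient q a lam x := by
  have hq : |q| < 1 := by rwa [abs_of_pos hq0]
  have hqc : ‖(q : ℂ)‖ < 1 := by simpa using hq
  have hx0 : x ≠ 0 := by simpa using hx 0 (h.zero_mem_support hq0 hq1 hlam)
  have h0 := h.phiShift_ne_zero hq0 hq1 hlam hx0 hx
  have h1 := h.integral_mul_phiShift hq0 hq1 hlam hx0 hx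
  rw [phiShift_one_eq hq hx0 fun j => hxa (j + 1)] at h1
  rw [phiShift_zero_eq hq hx0 hxa] at h0 h1
  have hphi := right_ne_zero_of_mul h0
  refine ⟨hphi, ?_⟩
  have hp : qPochInf (-(a * q) / x) q ≠ 0 :=
    qPochInf_ne_zero hqc (one_sub_neg_mul_div_mul_pow_ne_zero hx0 fun j => hxa (j + 1))
  have hxa0 : x + a ≠ 0 := fun h => hxa 0 (by rw [pow_zero, mul_one]; exact eq_neg_of_add_eq_zero_left h)
  have hrec : qPochInf (-a / x) q = (x + a) / x * qPochInf (-(a * q) / x) q := by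
    have := qPochInf_eq_qPoch_mul (-a / x) hqc 1
    simp only [qPoch, Finset.prod_range_one, pow_zero, mul_one, pow_one] at this
    rw [this, show -(a : ℂ) / x * q = -(a * q) / x by ring]
    congr 1
    field_simp
    ring
  rw [hrec] at h1
  rw [stieltjesQuotient]
  generalize phi01 (-(a * q) / x) q (lam * q ^ 2 / x ^ 2) = N at *
  generalize phi01 (-a / x) q (lam * q / x ^ 2) = D at *
  generalize qPochInf (-(a * q) / x) q = P at *
  generalize ∫ t : ℝ, 1 / (x - (t : ℂ)) ∂μ = S at *
  field_simp at h1 ⊢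
  linear_combination h1

lemma eventually_forall_ne_neg_mul_pow {q : ℝ} (a : ℝ) (hq : |q| < 1) {x : ℂ} (hx0 : x ≠ 0) :
    ∀ᶠ y : ℂ in 𝓝[≠] x, ∀ j : ℕ, y ≠ -(a * q ^ j) := by
  have hx' : 0 < ‖x‖ / 2 := by positivity
  have hlim : Tendsto (fun j : ℕ => ‖-((a : ℂ) * (q : ℂ) ^ j)‖) atTop (𝓝 0) := by
    have h := (tendsto_pow_atTop_nhds_zero_of_norm_lt_one (x := (q : ℂ)) (by simpa using hq))
    simpa using (h.const_mul (a : ℂ)).norm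
  obtain ⟨N, hN⟩ := eventually_atTop.1 (hlim.eventually_lt_const hx')
  have hbig : ∀ᶠ y : ℂ in 𝓝[≠] x, ‖x‖ / 2 < ‖y‖ :=
    (continuous_norm.continuousAt.eventually_const_lt (half_lt_self (norm_pos_iff.2 hx0))).filter_mono
      nhdsWithin_le_nhds
  have hsmall : ∀ᶠ y : ℂ in 𝓝[≠] x, ∀ j ∈ Finset.range N, y ≠ -(a * q ^ j) := by
    rw [eventually_all_finset]
    intro j _
    by_cases hj : x = -(a * q ^ j)
    · rw [← hj]
      exact self_mem_nhdsWithin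
    · exact (eventually_ne_nhds hj).filter_mono nhdsWithin_le_nhds
  filter_upwards [hbig, hsmall] with y hy1 hy2 j
  rcases lt_or_ge j N with hj | hj
  · exact hy2 j (Finset.mem_range.2 hj)
  · rintro rfl
    exact lt_asymm hy1 (hN j hj)

theorem tendsto_stieltjesQuotient (h : IsOrthogonalityMeasure q a lam μ) (hq0 : 0 < q)
    (hq1 : q < 1) (hlam : lam < 0) {x : ℂ} (hx : ∀ t ∈ μ.support, x ≠ (t : ℂ)) :
    Tendsto (stieltjesQuotient q a lam) (𝓝[≠] x) (𝓝 (∫ t : ℝ, 1 / (x - (t : ℂ)) ∂μ)) := by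
  have := h.isProbabilityMeasure
  have hx0 : x ≠ 0 := by simpa using hx 0 (h.zero_mem_support hq0 hq1 hlam)
  refine ((continuousAt_integral_one_div_sub hx).tendsto.mono_left nhdsWithin_le_nhds).congr' ?_
  filter_upwards [nhdsWithin_le_nhds (eventually_forall_support_ne hx),
    eventually_forall_ne_neg_mul_pow a (by rwa [abs_of_pos hq0]) hx0] with y hy hya
  exact (h.integral_eq_stieltjesQuotient hq0 hq1 hlam hy hya).2

end IsOrthogonalityMeasure

end

theorem mainTheorem6 (q a lam : ℝ) (hq0 : 0 < |q|) (hq1 : |q| < 1) (hlam : lam < 0) :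
    -- asymptotics of the denominator polynomials
    (∀ x : ℂ, x ≠ 0 → (∀ j : ℕ, x ≠ -(a * q ^ j)) →
      Tendsto (fun n : ℕ => aeval x (polyQ q a lam n) / x ^ n) atTop
        (𝓝 (qPochInf (-a / x) q * phi01 (-a / x) q (lam * q / x ^ 2))) ∧
      (phi01 (-a / x) q (lam * q / x ^ 2) ≠ 0 →
        (fun n : ℕ => aeval x (polyQ q a lam n)) ~[atTop]
          fun n : ℕ => x ^ n * qPochInf (-a / x) q * phi01 (-a / x) q (lam * q / x ^ 2))) ∧
    -- asymptotics of the numerator polynomials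
    (∀ x : ℂ, x ≠ 0 → (∀ j : ℕ, x ≠ -(a * q ^ (j + 1))) →
      Tendsto (fun n : ℕ => aeval x (polyQStar q a lam n) / x ^ ((n : ℤ) - 1)) atTop
        (𝓝 (qPochInf (-(a * q) / x) q * phi01 (-(a * q) / x) q (lam * q ^ 2 / x ^ 2))) ∧
      (phi01 (-(a * q) / x) q (lam * q ^ 2 / x ^ 2) ≠ 0 →
        (fun n : ℕ => aeval x (polyQStar q a lam n)) ~[atTop]
          fun n : ℕ => x ^ ((n : ℤ) - 1) * qPochInf (-(a * q) / x) q *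
            phi01 (-(a * q) / x) q (lam * q ^ 2 / x ^ 2))) ∧
    -- the orthogonality measure and its Stieltjes transform
    (0 < q → ∃ μ : Measure ℝ, IsOrthogonalityMeasure q a lam μ ∧
      (∀ ν : Measure ℝ, IsOrthogonalityMeasure q a lam ν → ν = μ) ∧
      ∀ x : ℂ, (∀ t ∈ μ.support, x ≠ (t : ℂ)) →
        Integrable (fun t : ℝ => 1 / (x - (t : ℂ))) μ ∧
        ((∀ j : ℕ, x ≠ -(a * q ^ j)) →
          phi01 (-a / x) q (lam * q / x ^ 2) ≠ 0 ∧
          ∫ t : ℝ, 1 / (x - (t : ℂ)) ∂μ = stieltjesQuotient q a lam x) ∧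
        -- at the points `-a q^j` the quotient is read as the limit
        Tendsto (stieltjesQuotient q a lam) (𝓝[≠] x)
          (𝓝 (∫ t : ℝ, 1 / (x - (t : ℂ)) ∂μ))) := by
  refine ⟨fun x hx h => polyQ_asymptotics hq1 a lam hx h,
    fun x hx h => polyQStar_asymptotics hq1 a lam hx h, fun hq => ?_⟩
  have hq' : q < 1 := (le_abs_self q).trans_lt hq1
  obtain ⟨μ, hμ, M, hM⟩ := exists_isOrthogonalityMeasure (a := a) hq hq' hlam
  have := hμ.isProbabilityMeasure
  exact ⟨μ, hμ, fun ν hν => hμ.unique hM hν, fun x hx => ⟨integrable_one_div_sub hx,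
    hμ.integral_eq_stieltjesQuotient hq hq' hlam hx,
    hμ.tendsto_stieltjesQuotient hq hq' hlam hx⟩⟩
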